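/- Let $R$ be a commutative noetherian ring, let $I,J$ be ideals of $R$, and let $M$ be a finitely generated $R$-module. Put $$\tilde W(I,J)=\{\mathfrak a \text{ an ideal of } R : I^n\subseteq \mathfrak a+J \text{ for some } n\ge 1\},\qquad W(I,J)=\{\mathfrak p\in\operatorname{Spec}R : I^n\subseteq \mathfrak p+J \text{ for some } n\ge 1\}.$$ For an $R$-module $X$ let $\Gamma_{I,J}(X)=\{x\in X : I^n x\subseteq Jx \text{ for } n\gg 0\}$, and let $H^i_{I,J}$ be the $i$-th right derived functor of $\Gamma_{I,J}$. For an ideal $\mathfrak a$ of a noetherian ring and a finitely generated module $N$ over it, let $\operatorname{depth}(\mathfrak a,N)$ be the maximal length of an $N$-regular sequence contained in $\mathfrak a$ if $\mathfrak aN\ne N$, and $\infty$ if $\mathfrak aN=N$; over a local ring with maximal ideal $\mathfrak m$ put $\operatorname{depth}N=\operatorname{depth}(\mathfrak m,N)$ (so $\operatorname{depth}0=\infty$). Define $$\operatorname{depth}(I,J,M)=\inf\{\operatorname{depth}(\mathfrak a,M) : \mathfrak a\in\tilde W(I,J)\}.$$ Then, with all infima taken in $\mathbb N_0\cup\{\infty\}$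 and $\inf\emptyset=\infty$, $$\operatorname{depth}(I,J,M)=\inf\{i\in\mathbb N_0 : H^i_{I,J}(M)\neq 0\}=\inf\{\operatorname{depth}(\mathfrak p,M) : \mathfrak p\in W(I,J)\}=\inf\{\operatorname{depth}M_{\mathfrak p} : \mathfrak p\in W(I,J)\},$$ where $\operatorname{depth}M_{\mathfrak p}$ is the depth of $M_{\mathfrak p}$ over the local ring $R_{\mathfrak p}$. -/

import Mathlib

open CategoryTheory

universe u v

namespace IdealPair

section

variable {R : Type u} [CommRing R]

/-- `W(I, J)`: the prime ideals `p` with `I ^ n ⊆ p + J` for some integer `n ≥ 1`. -/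
def W (I J : Ideal R) : Set (PrimeSpectrum R) :=
  {p | ∃ n : ℕ, 1 ≤ n ∧ I ^ n ≤ p.asIdeal ⊔ J}

/-- `W̃(I, J)`: all ideals `a` with `I ^ n ⊆ a + J` for some integer `n ≥ 1`. -/
def WTilde (I J : Ideal R) : Set (Ideal R) :=
  {a | ∃ n : ℕ, 1 ≤ n ∧ I ^ n ≤ a ⊔ J}

/-- `I ^ n x ⊆ J x` if and only if `I ^ n ⊆ Ann(x) + J`. -/
theorem smul_span_singleton_le_iff {M : Type v} [AddCommGroup M] [Module R M]
    (A J : Ideal R) (x : M) :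
    A • Submodule.span R {x} ≤ J • Submodule.span R {x} ↔
      A ≤ (Submodule.span R {x}).annihilator ⊔ J := by
  constructor
  · intro h a ha
    have h1 : a • x ∈ J • Submodule.span R {x} :=
      h (Submodule.smul_mem_smul ha (Submodule.mem_span_singleton_self x))
    obtain ⟨j, hj, hjx⟩ := Submodule.mem_smul_span_singleton.mp h1
    have h2 : a - j ∈ (Submodule.span R {x}).annihilator := by
      rw [Submodule.mem_annihilator_span_singleton, sub_smul, hjx, sub_self]
    have h3 := Submodule.add_mem_sup h2 hj
    rwa [sub_add_cancel] at h3
  · intro h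
    refine (Submodule.smul_mono_left h).trans ?_
    rw [Submodule.sup_smul, Submodule.annihilator_smul, bot_sup_eq]

theorem add_smul_span_le {M : Type v} [AddCommGroup M] [Module R M]
    (I J : Ideal R) (x y : M) (n m : ℕ)
    (hn : I ^ n • Submodule.span R {x} ≤ J • Submodule.span R {x})
    (hm : I ^ m • Submodule.span R {y} ≤ J • Submodule.span R {y}) :
    I ^ (n + m) • Submodule.span R {x + y} ≤ J • Submodule.span R {x + y} := by
  rw [smul_span_singleton_le_iff] at hn hm ⊢
  have key : (Submodule.span R {x}).annihilator ⊓ (Submodule.span R {y}).annihilator ≤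
      (Submodule.span R {x + y}).annihilator := by
    rintro r ⟨hx, hy⟩
    have hx' := (Submodule.mem_annihilator_span_singleton x r).mp hx
    have hy' := (Submodule.mem_annihilator_span_singleton y r).mp hy
    rw [Submodule.mem_annihilator_span_singleton, smul_add, hx', hy', add_zero]
  generalize (Submodule.span R {x}).annihilator = A at *
  generalize (Submodule.span R {y}).annihilator = B at *
  generalize (Submodule.span R {x + y}).annihilator = C at *
  calc I ^ (n + m) = I ^ n * I ^ m := pow_add I n m
    _ ≤ (A ⊔ J) * (B ⊔ J) := Ideal.mul_mono hn hm
    _ ≤ A * B ⊔ J := by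
      have h1 : A * J ≤ J := Ideal.mul_le_inf.trans inf_le_right
      have h2 : J * (B ⊔ J) ≤ J := Ideal.mul_le_inf.trans inf_le_left
      rw [Ideal.sup_mul, Ideal.mul_sup]
      exact sup_le (sup_le_sup_left h1 _) (h2.trans le_sup_right)
    _ ≤ C ⊔ J := sup_le_sup_right (Ideal.mul_le_inf.trans key) J

theorem smul_smul_span_le {M : Type v} [AddCommGroup M] [Module R M]
    (I J : Ideal R) (c : R) (x : M) (n : ℕ)
    (hn : I ^ n • Submodule.span R {x} ≤ J • Submodule.span R {x}) :
    I ^ n • Submodule.span R {c • x} ≤ J • Submodule.span R {c • x} := by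
  rw [smul_span_singleton_le_iff] at hn ⊢
  refine hn.trans (sup_le_sup_right (Submodule.annihilator_mono ?_) J)
  exact Submodule.span_singleton_smul_le R c x

/-- The `(I, J)`-torsion submodule
`Γ_{I,J}(M) = {x ∈ M | I ^ n x ⊆ J x for n large}`.
(If the inclusion holds for one `n`, it holds for all larger ones.) -/
def torsion (I J : Ideal R) (M : Type v) [AddCommGroup M] [Module R M] : Submodule R M where
  carrier := {x | ∃ n : ℕ, I ^ n • Submodule.span R {x} ≤ J • Submodule.span R {x}}
  zero_mem' := ⟨0, by rw [Submodule.span_zero_singleton, Submodule.smul_bot]; exact bot_le⟩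
  add_mem' := fun {x y} ⟨n, hn⟩ ⟨m, hm⟩ => ⟨n + m, add_smul_span_le I J x y n m hn hm⟩
  smul_mem' := fun c x ⟨n, hn⟩ => ⟨n, smul_smul_span_le I J c x n hn⟩

/-- Linear maps send `(I, J)`-torsion elements to `(I, J)`-torsion elements. -/
theorem map_mem_torsion (I J : Ideal R) {M N : Type v} [AddCommGroup M] [Module R M]
    [AddCommGroup N] [Module R N] (f : M →ₗ[R] N) (x : M) (hx : x ∈ torsion I J M) :
    f x ∈ torsion I J N := by
  obtain ⟨n, hn⟩ := hx
  refine ⟨n, ?_⟩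
  have h := Submodule.map_mono (f := f) hn
  simpa only [Submodule.map_smul'', Submodule.map_span, Set.image_singleton] using h

/-- The `(I, J)`-torsion functor `Γ_{I,J}` on `R`-modules; it acts on morphisms by restriction. -/
def torsionFunctor (I J : Ideal R) : ModuleCat.{u} R ⥤ ModuleCat.{u} R where
  obj M := ModuleCat.of R (torsion I J M)
  map f := ModuleCat.ofHom (f.hom.restrict (map_mem_torsion I J f.hom))

instance (I J : Ideal R) : (torsionFunctor I J).Additive where
  map_add := rfl

/-- The `i`-th local cohomology module `H^i_{I,J}(M)` of `M` with respect to the pair `(I, J)`: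
the `i`-th right derived functor of `Γ_{I,J}` applied to `M`. -/
noncomputable def localCohomology (I J : Ideal R) (i : ℕ) (M : Type u) [AddCommGroup M]
    [Module R M] : ModuleCat.{u} R :=
  ((torsionFunctor I J).rightDerived i).obj (ModuleCat.of R M)

open Classical in
/-- The depth (grade) of an ideal `a` on a finite module `M` over a noetherian ring: the maximal
length of an `M`-regular sequence contained in `a` if `a M ≠ M`, and `∞` if `a M = M`. -/
noncomputable def idealDepth (a : Ideal R) (M : Type v) [AddCommGroup M] [Module R M] : ℕ∞ :=
  if a • (⊤ : Submodule R M) = ⊤ then ⊤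
  else ⨆ (rs : List R) (_ : ∀ r ∈ rs, r ∈ a) (_ : RingTheory.Sequence.IsRegular M rs),
    (rs.length : ℕ∞)

/-- The depth of a module over a local ring: the depth of the maximal ideal on it. -/
noncomputable def localDepth (R : Type u) [CommRing R] [IsLocalRing R] (M : Type v)
    [AddCommGroup M] [Module R M] : ℕ∞ :=
  idealDepth (IsLocalRing.maximalIdeal R) M

/-- `depth(I, J, M)`, the infimum of `depth(a, M)` over `a ∈ W̃(I, J)`. -/
noncomputable def depth (I J : Ideal R) (M : Type v) [AddCommGroup M] [Module R M] : ℕ∞ :=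
  ⨅ a ∈ WTilde I J, idealDepth a M

end

end IdealPair

/-! Elements of `ℕ∞` are compared through the naturals below them. By `natCast_le_idealDepth_iff`,
`n ≤ depth(a, M)` means that `a` contains a weakly `M`-regular sequence of length `n`, with no
separate case for `aM = M`. Two facts then give all the equalities. Cohomology: by Rees, the
condition for `a` is the vanishing of `Ext^i(R/a, M)` for `i < n`. On an injective resolution `E`,
`Γ_{I,J}(E)` is the union of the images of `Hom(R/a, E)`, `a ∈ W̃(I,J)`. Hence vanishing of these
Ext gives vanishing of `H^i_{I,J}(M)`; the converse (`homExactAt_of_torsionExactAt`) is an induction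
on degree. Primes: the condition can be checked locally at the primes containing `a`
(`hasWeaklyRegular_iff_forall_localized`), and these lie in `W(I,J)` when `a ∈ W̃(I,J)`. -/

namespace IdealPair

open RingTheory.Sequence Abelian

/-! ### Weakly regular sequences and depth -/

section RegularSequences

variable {R : Type u} [CommRing R]

/-- The ideal `a` contains a weakly `M`-regular sequence of length `n`. -/
def HasWeaklyRegular (a : Ideal R) (M : Type v) [AddCommGroup M] [Module R M] (n : ℕ) : Prop :=
  ∃ rs : List R, rs.length = n ∧ (∀ r ∈ rs, r ∈ a) ∧ IsWeaklyRegular M rs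

variable {M : Type v} [AddCommGroup M] [Module R M] {a : Ideal R} {n : ℕ}

theorem HasWeaklyRegular.congr {M' : Type*} [AddCommGroup M'] [Module R M']
    (h : HasWeaklyRegular a M n) (e : M ≃ₗ[R] M') : HasWeaklyRegular a M' n := by
  obtain ⟨rs, h1, h2, h3⟩ := h
  exact ⟨rs, h1, h2, (e.isWeaklyRegular_congr rs).mp h3⟩

theorem HasWeaklyRegular.cons {x : R} (hx : x ∈ a) (hr : IsSMulRegular M x)
    (h : HasWeaklyRegular a (QuotSMulTop x M) n) : HasWeaklyRegular a M (n + 1) := by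
  obtain ⟨rs, h1, h2, h3⟩ := h
  refine ⟨x :: rs, by simp [h1], ?_, IsWeaklyRegular.cons hr h3⟩
  simpa using ⟨hx, h2⟩

theorem HasWeaklyRegular.exists_isSMulRegular (h : HasWeaklyRegular a M (n + 1)) :
    ∃ x ∈ a, IsSMulRegular M x := by
  obtain ⟨_ | ⟨x, rs⟩, h1, h2, h3⟩ := h
  · simp at h1
  · exact ⟨x, h2 x (by simp), ((isWeaklyRegular_cons_iff M x rs).mp h3).1⟩

theorem HasWeaklyRegular.of_subsingleton [Subsingleton M] (a : Ideal R) (n : ℕ) :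
    HasWeaklyRegular a M n := by
  refine ⟨List.replicate n 0, by simp, fun r hr => ?_, ?_⟩
  · rw [List.eq_of_mem_replicate hr]
    exact a.zero_mem
  · refine ⟨fun i hi => fun x y _ => ?_⟩
    exact Subsingleton.elim _ _

theorem isRegular_of_smul_top_ne_top {rs : List R} (ha : a • (⊤ : Submodule R M) ≠ ⊤)
    (hmem : ∀ r ∈ rs, r ∈ a) (h : IsWeaklyRegular M rs) : IsRegular M rs := by
  refine ⟨h, fun h' => ha (top_le_iff.mp ?_)⟩
  calc ⊤ ≤ Ideal.ofList rs • (⊤ : Submodule R M) := h'.le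
    _ ≤ _ := Submodule.smul_mono_left (Ideal.span_le.mpr hmem)

theorem exists_mem_forall_smul_eq [Module.Finite R M] (ha : a • (⊤ : Submodule R M) = ⊤) :
    ∃ r ∈ a, ∀ m : M, r • m = m := by
  obtain ⟨r, hr, h⟩ := Submodule.exists_mem_and_smul_eq_self_of_fg_of_le_smul a ⊤
    Module.Finite.fg_top ha.ge
  exact ⟨r, hr, fun m => h m trivial⟩

/-- By Nakayama some `r ∈ a` acts as the identity; it is regular and `M / rM = 0`, so zeros extend
it to any length. -/
theorem HasWeaklyRegular.of_smul_top_eq_top [Module.Finite R M]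
    (ha : a • (⊤ : Submodule R M) = ⊤) : HasWeaklyRegular a M n := by
  cases n with
  | zero => exact ⟨[], rfl, by simp, by simp⟩
  | succ n =>
    obtain ⟨r, hr, h⟩ := exists_mem_forall_smul_eq ha
    have : Subsingleton (QuotSMulTop r M) := by
      rw [Submodule.Quotient.subsingleton_iff, eq_top_iff]
      intro m _
      rw [← h m]
      exact Submodule.smul_mem_pointwise_smul _ _ _ trivial
    refine HasWeaklyRegular.cons hr (fun x y hxy => ?_) (HasWeaklyRegular.of_subsingleton a n)
    simpa [h] using hxy

theorem natCast_le_idealDepth_iff [Module.Finite R M] :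
    (n : ℕ∞) ≤ idealDepth a M ↔ HasWeaklyRegular a M n := by
  unfold idealDepth
  split_ifs with ha
  · simpa using HasWeaklyRegular.of_smul_top_eq_top ha
  constructor
  · intro h
    cases n with
    | zero => exact ⟨[], rfl, by simp, by simp⟩
    | succ n =>
      have h' := (ENat.natCast_lt_natCast.mpr n.lt_succ_self).trans_le h
      simp only [lt_iSup_iff] at h'
      obtain ⟨rs, hm, hr, hl⟩ := h'
      rw [ENat.natCast_lt_natCast] at hl
      -- The supremum only yields a sequence of length greater than `n`, hence the truncation.
      refine ⟨rs.take (n + 1), by simp; omega, fun r hr => hm r (List.mem_of_mem_take hr), ?_⟩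
      have := hr.1
      rw [← List.take_append_drop (n + 1) rs, isWeaklyRegular_append_iff] at this
      exact this.1
  · rintro ⟨rs, rfl, hm, hr⟩
    exact le_iSup₂_of_le rs hm (le_iSup_of_le (isRegular_of_smul_top_ne_top ha hm hr) le_rfl)

end RegularSequences

/-! ### Rees' theorem: regular sequences and vanishing of Ext -/

section Ext

variable {R : Type u} [CommRing R] {a : Ideal R} {n : ℕ}

/-- Some `r ∈ a` acts as the identity on `M`, while a power of `r` kills `N`; so the identity of Ext
is zero. -/
theorem subsingleton_ext_of_smul_top_eq_top {M N : ModuleCat.{u} R} [Module.Finite R M]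
    [Module.Finite R N] (ha : a • (⊤ : Submodule R M) = ⊤)
    (hN : Module.support R N ⊆ PrimeSpectrum.zeroLocus a) (i : ℕ) : Subsingleton (Ext N M i) := by
  obtain ⟨r, hr, h⟩ := exists_mem_forall_smul_eq ha
  rw [Module.support_eq_zeroLocus, PrimeSpectrum.zeroLocus_subset_zeroLocus_iff] at hN
  obtain ⟨k, hk⟩ := hN hr
  have hk1 : r ^ k • 𝟙 M = 𝟙 M := by
    ext m
    have : ∀ k : ℕ, r ^ k • m = m := by
      intro k
      induction k with
      | zero => simp
      | succ k ih => rw [pow_succ, mul_smul, h, ih]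
    exact this k
  have h0 := Ext.postcomp_smul_id_eq_zero_of_mem_annihilator (M := M) hk i
  rw [hk1] at h0
  refine subsingleton_of_forall_eq 0 fun e => ?_
  have := ConcreteCategory.congr_hom h0 e
  simpa using this

theorem support_quotient_eq (a : Ideal R) :
    Module.support R (R ⧸ a) = PrimeSpectrum.zeroLocus a := by
  rw [Module.support_eq_zeroLocus, Ideal.annihilator_quotient]

variable [IsNoetherianRing R]

theorem HasWeaklyRegular.subsingleton_ext {M N : ModuleCat.{u} R} [Module.Finite R M]
    [Module.Finite R N] (h : HasWeaklyRegular a M n)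
    (hN : Module.support R N ⊆ PrimeSpectrum.zeroLocus a) {i : ℕ} (hi : i < n) :
    Subsingleton (Ext N M i) := by
  by_cases ha : a • (⊤ : Submodule R M) = ⊤
  · exact subsingleton_ext_of_smul_top_eq_top ha hN i
  · obtain ⟨rs, rfl, h1, h2⟩ := h
    exact ModuleCat.subsingleton_ext_of_exists_isRegular a N hN M (lt_top_iff_ne_top.mpr ha) rs h1
      (isRegular_of_smul_top_ne_top ha h1 h2) i hi

theorem hasWeaklyRegular_of_subsingleton_ext {M : ModuleCat.{u} R} [Module.Finite R M]
    (h : ∀ i < n, Subsingleton (Ext (ModuleCat.of R (R ⧸ a)) M i)) : HasWeaklyRegular a M n := by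
  by_cases ha : a • (⊤ : Submodule R M) = ⊤
  · exact .of_smul_top_eq_top ha
  · obtain ⟨rs, h1, h2, h3⟩ := ModuleCat.exists_isRegular_of_exists_subsingleton_ext a n M
      (lt_top_iff_ne_top.mpr ha) (ModuleCat.of R (R ⧸ a)) (support_quotient_eq a) h
    exact ⟨rs, h1, h2, h3.1⟩

/-- The given sequence need not start with `x`; the long exact Ext sequence of `0 → M → M → M/xM →
0` avoids any exchange argument. -/
theorem HasWeaklyRegular.quotSMulTop {M : Type u} [AddCommGroup M] [Module R M]
    [Module.Finite R M] {x : R} (hx : IsSMulRegular M x) (h : HasWeaklyRegular a M (n + 1)) :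
    HasWeaklyRegular a (QuotSMulTop x M) n := by
  have h' : ∀ i < n + 1, Subsingleton (Ext (ModuleCat.of R (R ⧸ a)) (ModuleCat.of R M) i) :=
    fun i hi => HasWeaklyRegular.subsingleton_ext (M := ModuleCat.of R M) h
      (support_quotient_eq a).subset hi
  refine hasWeaklyRegular_of_subsingleton_ext (M := ModuleCat.of R (QuotSMulTop x M))
    fun i hi => ?_
  have zero1 := AddCommGrpCat.isZero_of_iff_subsingleton.mpr (h' i (by omega))
  have zero2 := AddCommGrpCat.isZero_of_iff_subsingleton.mpr (h' (i + 1) (by omega))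
  have hx' : IsSMulRegular (ModuleCat.of R M) x := hx
  exact AddCommGrpCat.subsingleton_of_isZero <| ShortComplex.Exact.isZero_of_both_zeros
    ((Ext.covariant_sequence_exact₃' (ModuleCat.of R (R ⧸ a)) hx'.smulShortComplex_shortExact)
      i (i + 1) rfl)
    (zero1.eq_zero_of_src _) (zero2.eq_zero_of_tgt _)

end Ext

/-! ### Depth is local -/

section Localization

variable {R : Type u} [CommRing R] {n : ℕ}

theorem HasWeaklyRegular.localized {M : Type v} [AddCommGroup M] [Module R M] {a : Ideal R}
    (h : HasWeaklyRegular a M n) (p : Ideal R) [p.IsPrime] (hp : a ≤ p) :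
    HasWeaklyRegular (IsLocalRing.maximalIdeal (Localization.AtPrime p))
      (LocalizedModule.AtPrime p M) n := by
  obtain ⟨rs, h1, h2, h3⟩ := h
  refine ⟨rs.map (algebraMap R (Localization.AtPrime p)), by simpa, ?_,
    h3.of_isLocalizedModule (Localization.AtPrime p) p.primeCompl
      (LocalizedModule.mkLinearMap p.primeCompl M)⟩
  intro r hr
  obtain ⟨s, hs, rfl⟩ := List.mem_map.mp hr
  exact (IsLocalization.AtPrime.to_map_mem_maximal_iff _ p s).mpr (hp (h2 s hs))

/-- Localization at a prime commutes with `M ↦ M / x M`. -/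
noncomputable def quotSMulTopLocalizedEquiv (M : Type v) [AddCommGroup M] [Module R M]
    (p : Ideal R) [p.IsPrime] (x : R) :
    QuotSMulTop (algebraMap R (Localization.AtPrime p) x) (LocalizedModule.AtPrime p M)
      ≃ₗ[Localization.AtPrime p] LocalizedModule.AtPrime p (QuotSMulTop x M) :=
  ((QuotSMulTop.algebraMapTensorEquivTensorQuotSMulTop x M (Localization.AtPrime p)).symm ≪≫ₗ
    QuotSMulTop.congr (algebraMap R (Localization.AtPrime p) x)
      (IsLocalizedModule.isBaseChange p.primeCompl (Localization.AtPrime p)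
        (LocalizedModule.mkLinearMap p.primeCompl M)).equiv).symm ≪≫ₗ
  (IsLocalizedModule.isBaseChange p.primeCompl (Localization.AtPrime p)
    (LocalizedModule.mkLinearMap p.primeCompl (QuotSMulTop x M))).equiv

theorem notMem_associatedPrimes_of_hasWeaklyRegular [IsNoetherianRing R]
    {M : Type u} [AddCommGroup M] [Module R M] (p : Ideal R) [p.IsPrime]
    (h : HasWeaklyRegular (IsLocalRing.maximalIdeal (Localization.AtPrime p))
      (LocalizedModule.AtPrime p M) (n + 1)) : p ∉ associatedPrimes R M := by
  intro hp
  have hp' := Module.associatedPrimes.mem_associatedPrimes_atPrime_of_mem_associatedPrimes hp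
  obtain ⟨x, hx, hr⟩ := h.exists_isSMulRegular
  have := Set.mem_biUnion hp' hx
  rw [biUnion_associatedPrimes_eq_compl_regular] at this
  exact this hr

theorem hasWeaklyRegular_iff_forall_localized [IsNoetherianRing R]
    {M : Type u} [AddCommGroup M] [Module R M] [Module.Finite R M] {a : Ideal R} :
    HasWeaklyRegular a M n ↔ ∀ p : PrimeSpectrum R, a ≤ p.asIdeal →
      HasWeaklyRegular (IsLocalRing.maximalIdeal (Localization.AtPrime p.asIdeal))
        (LocalizedModule.AtPrime p.asIdeal M) n := by
  refine ⟨fun h p hp => h.localized p.asIdeal hp, fun h => ?_⟩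
  induction n generalizing M with
  | zero => exact ⟨[], rfl, by simp, by simp⟩
  | succ n ih =>
    obtain ⟨x, hx, hr⟩ : ∃ x ∈ a, IsSMulRegular M x := by
      -- Prime avoidance: otherwise `a` lies in an associated prime `p` of `M`, and `pR_p` is
      -- associated to `M_p`, so it contains no `M_p`-regular element.
      by_contra! hcon
      have hsub : (a : Set R) ⊆ ⋃ p ∈ associatedPrimes R M, (p : Set R) := by
        rw [biUnion_associatedPrimes_eq_compl_regular]
        exact fun r hr => hcon r hr
      obtain ⟨p, hp, hap⟩ := (Ideal.subset_union_prime_finite (associatedPrimes.finite R M) a a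
        fun p hp _ _ => IsAssociatedPrime.isPrime hp).mp hsub
      have := IsAssociatedPrime.isPrime hp
      exact notMem_associatedPrimes_of_hasWeaklyRegular p (h ⟨p, this⟩ hap) hp
    refine .cons hx hr (ih fun p hp => ?_)
    refine (HasWeaklyRegular.quotSMulTop ?_ (h p hp)).congr (quotSMulTopLocalizedEquiv M p.asIdeal x)
    exact hr.of_flat_of_isBaseChange (IsLocalizedModule.isBaseChange p.asIdeal.primeCompl
      (Localization.AtPrime p.asIdeal) (LocalizedModule.mkLinearMap p.asIdeal.primeCompl M))

end Localization

/-! ### Torsion elements and their annihilators -/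

section Torsion

variable {R : Type u} [CommRing R] {I J : Ideal R}

theorem mem_WTilde_of_le {a b : Ideal R} (ha : a ∈ WTilde I J) (h : a ≤ b) : b ∈ WTilde I J := by
  obtain ⟨n, hn, h'⟩ := ha
  exact ⟨n, hn, h'.trans (sup_le_sup_right h J)⟩

theorem mem_torsion_iff {M : Type v} [AddCommGroup M] [Module R M] {x : M} :
    x ∈ torsion I J M ↔ (Submodule.span R {x}).annihilator ∈ WTilde I J := by
  constructor
  · rintro ⟨n, hn⟩
    exact ⟨n + 1, by omega, (Ideal.pow_le_pow_right n.le_succ).trans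
      ((smul_span_singleton_le_iff _ _ _).mp hn)⟩
  · rintro ⟨n, -, hn⟩
    exact ⟨n, (smul_span_singleton_le_iff _ _ _).mpr hn⟩

theorem torsion_eq_top_of_annihilator_mem {M : Type v} [AddCommGroup M] [Module R M]
    (h : Module.annihilator R M ∈ WTilde I J) : torsion I J M = ⊤ := by
  refine eq_top_iff.mpr fun x _ => mem_torsion_iff.mpr (mem_WTilde_of_le h fun r hr => ?_)
  rw [Submodule.mem_annihilator_span_singleton]
  exact Module.mem_annihilator.mp hr x

theorem torsion_coe_mem {M : Type v} [AddCommGroup M] [Module R M] {N : Submodule R M} {x : N} :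
    x ∈ torsion I J N ↔ (x : M) ∈ torsion I J M := by
  refine ⟨map_mem_torsion I J N.subtype x, fun h => ?_⟩
  rw [mem_torsion_iff] at h ⊢
  refine mem_WTilde_of_le h fun r hr => ?_
  rw [Submodule.mem_annihilator_span_singleton] at hr ⊢
  exact Subtype.ext hr

theorem torsion_eq_top_of_le {M : Type v} [AddCommGroup M] [Module R M] {N : Submodule R M}
    (h : N ≤ torsion I J M) : torsion I J N = ⊤ :=
  eq_top_iff.mpr fun x _ => torsion_coe_mem.mpr (h x.2)

end Torsion

/-! ### Comparing `Γ_{I,J}` and `Hom` on complexes -/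

section Complex

variable {R : Type u} [CommRing R] {I J : Ideal R}

/-- The complex `Hom(N, K)` is exact in degree `i`. -/
def HomExactAt (K : CochainComplex (ModuleCat.{u} R) ℕ) (N : ModuleCat.{u} R) (i : ℕ) : Prop :=
  ∀ f : N ⟶ K.X i, f ≫ K.d i (i + 1) = 0 → ∃ g : N ⟶ K.X (i - 1), g ≫ K.d (i - 1) i = f

/-- The complex `Γ_{I,J}(K)` is exact in degree `i`. -/
def TorsionExactAt (I J : Ideal R) (K : CochainComplex (ModuleCat.{u} R) ℕ) (i : ℕ) : Prop :=
  ∀ z ∈ torsion I J (K.X i), K.d i (i + 1) z = 0 →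
    ∃ w ∈ torsion I J (K.X (i - 1)), K.d (i - 1) i w = z

theorem exactAt_mapHomologicalComplex_iff (K : CochainComplex (ModuleCat.{u} R) ℕ) (i : ℕ) :
    (((torsionFunctor I J).mapHomologicalComplex _).obj K).ExactAt i ↔
      TorsionExactAt I J K i := by
  rw [HomologicalComplex.exactAt_iff' _ (i - 1) i (i + 1) (by cases i <;> simp) (by simp),
    ShortComplex.moduleCat_exact_iff]
  constructor
  · intro h z hz hdz
    obtain ⟨w, hw⟩ := h ⟨z, hz⟩ (Subtype.ext hdz)
    exact ⟨w.1, w.2, congrArg Subtype.val hw⟩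
  · intro h z hz
    obtain ⟨w, hw, hdw⟩ := h z.1 z.2 (congrArg Subtype.val hz)
    exact ⟨⟨w, hw⟩, Subtype.ext hdw⟩

theorem subsingleton_localCohomology_iff {M : Type u} [AddCommGroup M] [Module R M]
    (E : InjectiveResolution (ModuleCat.of R M)) (i : ℕ) :
    Subsingleton (localCohomology I J i M) ↔ TorsionExactAt I J E.cocomplex i := by
  rw [← exactAt_mapHomologicalComplex_iff, HomologicalComplex.exactAt_iff_isZero_homology,
    ← ModuleCat.isZero_iff_subsingleton]
  exact (E.isoRightDerivedObj (torsionFunctor I J) i).isZero_iff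

theorem subsingleton_ext_iff {M N : ModuleCat.{u} R} (E : InjectiveResolution M) (i : ℕ) :
    Subsingleton (Ext N M i) ↔ HomExactAt E.cocomplex N i := by
  cases i with
  | zero =>
    let ι : M ⟶ E.cocomplex.X 0 := E.ι.f 0
    have hι : Mono ι := inferInstanceAs (Mono (E.ι.f 0))
    rw [Ext.addEquiv₀.subsingleton_congr]
    constructor
    · intro h f hf
      -- Here `i - 1 = 0` and the differential from degree 0 to itself is zero, so exactness means
      -- `f = 0`.
      refine ⟨0, ?_⟩
      obtain ⟨g, hg⟩ : ∃ g : N ⟶ M, g ≫ ι = f :=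
        ⟨_, (Limits.KernelFork.IsLimit.lift' E.isLimitKernelFork f hf).2⟩
      rw [← hg, Subsingleton.elim g 0]
      simp
    · intro h
      refine subsingleton_of_forall_eq 0 fun g => ?_
      obtain ⟨k, hk⟩ := h (g ≫ ι) (by
        have h0 : ι ≫ E.cocomplex.d 0 (0 + 1) = 0 := E.ι_f_zero_comp_complex_d
        rw [Category.assoc, h0, Limits.comp_zero])
      rw [← cancel_mono ι, ← hk]
      simp
  | succ i =>
    constructor
    · intro h f hf
      exact (E.extMk_eq_zero_iff f (i + 2) rfl hf i rfl).mp (Subsingleton.elim _ _)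
    · intro h
      refine subsingleton_of_forall_eq 0 fun α => ?_
      obtain ⟨f, hf, rfl⟩ := E.extMk_surjective α (i + 2) rfl
      exact (E.extMk_eq_zero_iff f (i + 2) rfl hf i rfl).mpr (h f hf)

/-- A torsion cycle `z` is a map from `R/Ann(z)`, and `Ann(z) ∈ W̃(I,J)`; the image of 1 under a
lift of that map is again torsion. -/
theorem torsionExactAt_of_homExactAt {K : CochainComplex (ModuleCat.{u} R) ℕ} {i : ℕ}
    (h : ∀ a ∈ WTilde I J, HomExactAt K (ModuleCat.of R (R ⧸ a)) i) : TorsionExactAt I J K i := by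
  intro z hz hdz
  have ha := mem_torsion_iff.mp hz
  set a := (Submodule.span R {z}).annihilator
  have hle : a ≤ LinearMap.ker (LinearMap.toSpanSingleton R (K.X i) z) := fun r hr =>
    (Submodule.mem_annihilator_span_singleton z r).mp hr
  let φ : (R ⧸ a) →ₗ[R] K.X i := Submodule.liftQ a _ hle
  have hφ : φ (Submodule.Quotient.mk 1) = z :=
    (Submodule.liftQ_apply _ _ _).trans (one_smul R z)
  obtain ⟨g, hg⟩ := h a ha (ModuleCat.ofHom φ) (by
    ext
    change K.d i (i + 1) (φ (Submodule.Quotient.mk 1)) = 0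
    rw [hφ, hdz])
  refine ⟨g (Submodule.Quotient.mk 1), map_mem_torsion I J g.hom _ ?_, ?_⟩
  · rw [torsion_eq_top_of_annihilator_mem]
    · trivial
    · rwa [Ideal.annihilator_quotient]
  · exact (ConcreteCategory.congr_hom hg (Submodule.Quotient.mk 1)).trans hφ

/-- Lift `f` on a free cover `π` of `N` to a torsion-valued `γ`. The obstruction to descending to
`N` is `γ` on `ker π`; the lower degrees make it a boundary, and injectivity allows correcting `γ`.
-/
theorem homExactAt_of_torsionExactAt [IsNoetherianRing R]
    {K : CochainComplex (ModuleCat.{u} R) ℕ} (hK : ∀ i, Injective (K.X i)) {i : ℕ}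
    (h : ∀ j ≤ i, TorsionExactAt I J K j) (N : ModuleCat.{u} R) [Module.Finite R N]
    (hN : torsion I J N = ⊤) : HomExactAt K N i := by
  induction i generalizing N with
  | zero =>
    intro f hf
    refine ⟨0, ?_⟩
    ext x
    obtain ⟨w, -, hw⟩ := h 0 le_rfl (f x) (map_mem_torsion I J f.hom x (hN ▸ trivial))
      (ConcreteCategory.congr_hom hf x)
    rw [← hw]
    simp
  | succ i ih =>
    intro f hf
    change ∃ g : N ⟶ K.X i, g ≫ K.d i (i + 1) = f
    obtain ⟨k, π, hπ⟩ := Module.Finite.exists_fin' R N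
    -- a lift of `f ∘ π` along the differential, with values in the torsion submodule
    have hlift : ∀ t : Fin k, ∃ w ∈ torsion I J (K.X i),
        K.d i (i + 1) w = f (π (Pi.single t 1)) := fun t =>
      h (i + 1) le_rfl _ (map_mem_torsion I J f.hom _ (hN ▸ trivial))
        (ConcreteCategory.congr_hom hf _)
    choose w hw hdw using hlift
    let γ : (Fin k → R) →ₗ[R] K.X i := (Pi.basisFun R (Fin k)).constr R w
    have hγ : (K.d i (i + 1)).hom ∘ₗ γ = f.hom ∘ₗ π := by
      refine (Pi.basisFun R (Fin k)).ext fun t => ?_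
      simp [γ, hdw]
    have hγt : LinearMap.range γ ≤ torsion I J (K.X i) := by
      rw [Module.Basis.constr_range, Submodule.span_le]
      rintro _ ⟨t, rfl⟩
      exact hw t
    -- `Z` is finitely generated, torsion and made of cycles, so the induction hypothesis applies to
    -- its inclusion.
    let Z : Submodule R (K.X i) := (LinearMap.ker π).map γ
    have hZt : torsion I J Z = ⊤ := torsion_eq_top_of_le (LinearMap.map_le_range.trans hγt)
    obtain ⟨v, hv⟩ := ih (fun j hj => h j (by omega)) (ModuleCat.of R Z) hZt
      (ModuleCat.ofHom Z.subtype) (by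
        ext ⟨_, y, hy, rfl⟩
        have := LinearMap.congr_fun hγ y
        simp only [LinearMap.comp_apply, LinearMap.mem_ker.mp hy, map_zero] at this
        exact this)
    -- extend `v ∘ γ` from the kernel of `π` to the free module
    have hinj : Module.Injective R (K.X (i - 1)) :=
      (Module.injective_iff_injective_object R _).mpr (hK (i - 1))
    obtain ⟨δ, hδ⟩ := Module.Injective.extension_property R _ _ _ (LinearMap.ker π).subtype
      (Submodule.subtype_injective _)
      (v.hom ∘ₗ γ.restrict (p := LinearMap.ker π) (q := Z) fun y hy => ⟨y, hy, rfl⟩)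
    -- The corrected lift `γ - dδ` kills `ker π`, and `d² = 0` leaves its differential equal to `f ∘
    -- π`.
    have hker : LinearMap.ker π ≤ LinearMap.ker (γ - (K.d (i - 1) i).hom ∘ₗ δ) := by
      intro y hy
      have h1 := LinearMap.congr_fun hδ ⟨y, hy⟩
      have h2 := ConcreteCategory.congr_hom hv (⟨γ y, y, hy, rfl⟩ : Z)
      simp only [LinearMap.comp_apply, Submodule.subtype_apply] at h1
      rw [LinearMap.mem_ker, LinearMap.sub_apply, LinearMap.comp_apply, h1, sub_eq_zero]
      exact h2.symm
    let e := π.quotKerEquivOfSurjective hπ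
    refine ⟨ModuleCat.ofHom ((LinearMap.ker π).liftQ _ hker ∘ₗ e.symm.toLinearMap), ?_⟩
    ext x
    obtain ⟨y, rfl⟩ := hπ x
    have he : e.symm (π y) = Submodule.Quotient.mk y := by
      rw [LinearEquiv.symm_apply_eq]
      rfl
    have h1 := LinearMap.congr_fun hγ y
    have h2 := ConcreteCategory.congr_hom (K.d_comp_d (i - 1) i (i + 1)) (δ y)
    simp only [LinearMap.comp_apply] at h1
    simp only [ModuleCat.hom_comp, ModuleCat.hom_ofHom, LinearMap.comp_apply,
      LinearEquiv.coe_coe, he]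
    change (K.d i (i + 1)).hom (γ y - (K.d (i - 1) i).hom (δ y)) = f.hom (π y)
    rw [map_sub, h1, sub_eq_self]
    exact h2

end Complex

/-! ### The equalities, one natural number at a time -/

variable {R : Type u} [CommRing R] (I J : Ideal R)
  (M : Type u) [AddCommGroup M] [Module R M] [Module.Finite R M]

theorem natCast_le_depth_iff (n : ℕ) :
    (n : ℕ∞) ≤ depth I J M ↔ ∀ a ∈ WTilde I J, HasWeaklyRegular a M n := by
  simp only [depth, le_iInf_iff, natCast_le_idealDepth_iff]

variable [IsNoetherianRing R]

theorem subsingleton_localCohomology_iff_hasWeaklyRegular (n : ℕ) :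
    (∀ i < n, Subsingleton (localCohomology I J i M)) ↔
      ∀ a ∈ WTilde I J, HasWeaklyRegular a M n := by
  let E := injectiveResolution (ModuleCat.of R M)
  constructor
  · intro h a ha
    refine hasWeaklyRegular_of_subsingleton_ext (M := ModuleCat.of R M) fun i hi => ?_
    refine (subsingleton_ext_iff E i).mpr (homExactAt_of_torsionExactAt (I := I) (J := J)
      E.injective (fun j hj => (subsingleton_localCohomology_iff E j).mp (h j (by omega))) _ ?_)
    exact torsion_eq_top_of_annihilator_mem (by rwa [Ideal.annihilator_quotient])
  · intro h i hi
    refine (subsingleton_localCohomology_iff E i).mpr (torsionExactAt_of_homExactAt fun a ha => ?_)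
    exact (subsingleton_ext_iff E i).mp (HasWeaklyRegular.subsingleton_ext
      (M := ModuleCat.of R M) (h a ha) (support_quotient_eq a).subset hi)

theorem forall_mem_WTilde_hasWeaklyRegular_iff (n : ℕ) :
    (∀ a ∈ WTilde I J, HasWeaklyRegular a M n) ↔
      ∀ p ∈ W I J, HasWeaklyRegular (IsLocalRing.maximalIdeal (Localization.AtPrime p.asIdeal))
        (LocalizedModule.AtPrime p.asIdeal M) n :=
  ⟨fun h p hp => (h p.asIdeal hp).localized p.asIdeal le_rfl, fun h _ ha =>
    hasWeaklyRegular_iff_forall_localized.mpr fun p hp => h p (mem_WTilde_of_le ha hp)⟩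

end IdealPair

theorem proposition3p3 {R : Type u} [CommRing R] [IsNoetherianRing R] (I J : Ideal R)
    (M : Type u) [AddCommGroup M] [Module R M] [Module.Finite R M] :
    IdealPair.depth I J M =
        ⨅ (i : ℕ) (_ : Nontrivial (IdealPair.localCohomology I J i M)), (i : ℕ∞) ∧
    IdealPair.depth I J M =
        ⨅ p ∈ IdealPair.W I J, IdealPair.idealDepth p.asIdeal M ∧
    IdealPair.depth I J M =
        ⨅ p ∈ IdealPair.W I J, IdealPair.localDepth (Localization.AtPrime p.asIdeal)
          (LocalizedModule.AtPrime p.asIdeal M) := by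
  refine ⟨ENat.eq_of_forall_natCast_le_iff fun n => ?_,
    ENat.eq_of_forall_natCast_le_iff fun n => ?_, ENat.eq_of_forall_natCast_le_iff fun n => ?_⟩ <;>
  rw [IdealPair.natCast_le_depth_iff]
  · rw [← IdealPair.subsingleton_localCohomology_iff_hasWeaklyRegular]
    simp only [le_iInf_iff, Nat.cast_le]
    refine forall_congr' fun i => ?_
    rw [← not_imp_not, not_lt, not_subsingleton_iff_nontrivial]
  · simp only [le_iInf_iff, IdealPair.natCast_le_idealDepth_iff]
    refine ⟨fun h p hp => h p.asIdeal hp, fun h => ?_⟩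
    rw [IdealPair.forall_mem_WTilde_hasWeaklyRegular_iff]
    exact fun p hp => (h p hp).localized p.asIdeal le_rfl
  · simp only [le_iInf_iff, IdealPair.localDepth, IdealPair.natCast_le_idealDepth_iff,
      IdealPair.forall_mem_WTilde_hasWeaklyRegular_iff]
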